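/- Let $K$ be a number field, $v$ a finite place of $K$, $\Lambda$ the completion of $\mathcal O_K$ at $v$, $\eta=\operatorname{Spec} K_v$ the generic point of $\operatorname{Spec}\Lambda$, $k(v)$ the (finite) residue field, with $N(v)$ elements, and write $v=\operatorname{Spec} k(v)$ also for the closed point. Let $CH^p(-,n)$ be Bloch's higher Chow groups, defined by the simplicial cycle complex $z^p(-,\bullet)$, with $CH^p(-)=CH^p(-,0)$. Take $X=\eta$ (that is, $\operatorname{Spec} K$ at $v$) with model $\operatorname{Spec}\Lambda$. The $v$-adic Deligne cohomology group is $$H^1_{\mathcal D}(X_{/v},\mathbb Q(1))=CH^0(v)\otimes\mathbb Q .$$ (In general it is $\operatorname{Ker}(i^*i_*)/\operatorname{Im}(\gamma)\otimes\mathbb Q$ for the components of the special fibre; here $\gamma=0$ because the special fibre is irreducible, and $i^*i_*=0$ because $CH^1(\operatorname{Spec}\Lambda)=0$ and $CH^1(v)=0$.) Then the connecting relation of $z^0(v,\bullet)\to z^1(\operatorname{Spec}\Lambda,\bullet)\to z^1(\eta,\bullet)$ is the graph of a homomorphism $\partial: CH^1(\eta,1)\to CH^0(v)$, the boundary map of the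 localization sequence. Let the $v$-adic regulator be $r_{\mathcal D,v}: CH^1(\eta,1)\to H^1_{\mathcal D}(X_{/v},\mathbb Q(1))$, $x\mapsto \partial x\otimes 1$. The following hold. 1. $CH^1(\operatorname{Spec}\Lambda)=0$ and $CH^1(v)=0$. 2. $\partial$ is surjective, and so is the $\mathbb Q$-linear extension $r_{\mathcal D,v}\otimes\mathbb Q: CH^1(\eta,1)\otimes\mathbb Q\to H^1_{\mathcal D}(X_{/v},\mathbb Q(1))$. 3. $H^1_{\mathcal D}(X_{/v},\mathbb Q(1))$ has dimension $1$ over $\mathbb Q$, and the image of $r_{\mathcal D,v}$ is a full sublattice in it (a finitely generated subgroup that spans it over $\mathbb Q$), of rank $1$. 4. For every prime $\ell\nmid N(v)$, every embedding $\mathbb Q_\ell\hookrightarrow\mathbb C$ and every geometric Frobenius $F^*$ at $v$, the local $L$-factor is $$L_v(X,s):=\det\bigl(1-F^*N(v)^{-s}\,\big|\,H^0(\bar X,\mathbb Q_\ell)^{I}\bigr)^{-1}=\frac{1}{1-N(v)^{-s}},$$ where $\bar X=\operatorname{Spec}\overline{K_v}$ and $I$ is the inertia group. This function has a pole of order exactly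 $1$ at $s=0$, so the order of the pole is the rank of the image of $r_{\mathcal D,v}$. -/

import Mathlib

open scoped TensorProduct

noncomputable section

/-! ### The algebraic simplices -/

/-- The coordinate ring `A[t₀,…,tₙ] / (t₀ + ⋯ + tₙ - 1)` of the algebraic simplex `Δⁿ` over
`Spec A`. -/
abbrev SimplexRing (A : Type*) [CommRing A] (n : ℕ) : Type _ :=
  MvPolynomial (Fin (n + 1)) A ⧸
    Ideal.span {(∑ i, MvPolynomial.X i - 1 : MvPolynomial (Fin (n + 1)) A)}

namespace SimplexRing

variable (A : Type*) [CommRing A]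

/-- The barycentric coordinate `tᵢ` on `Δⁿ`. -/
def coord {n : ℕ} (i : Fin (n + 1)) : SimplexRing A n :=
  Ideal.Quotient.mk _ (MvPolynomial.X i)

theorem sum_coord (n : ℕ) : ∑ i : Fin (n + 1), coord A i = 1 := by
  have h : Ideal.Quotient.mk
      (Ideal.span {(∑ i, MvPolynomial.X i - 1 : MvPolynomial (Fin (n + 1)) A)})
      (∑ i, MvPolynomial.X i - 1) = 0 :=
    Ideal.Quotient.eq_zero_iff_mem.2 (Ideal.subset_span rfl)
  rw [map_sub, map_sum, map_one, sub_eq_zero] at h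
  exact h

/-- The map `Δᵐ → Δⁿ` attached to a map `φ` of vertices, on coordinate rings:
`tᵢ ↦ ∑_{φ j = i} tⱼ`. -/
def pull {m n : ℕ} (φ : Fin (m + 1) → Fin (n + 1)) : SimplexRing A n →ₐ[A] SimplexRing A m :=
  Ideal.Quotient.liftₐ _
    (MvPolynomial.aeval fun i => ∑ j, if φ j = i then coord A j else 0) (by
      intro a ha
      have hle : Ideal.span {(∑ i, MvPolynomial.X i - 1 : MvPolynomial (Fin (n + 1)) A)} ≤
          RingHom.ker (MvPolynomial.aeval
            fun i => ∑ j, if φ j = i then coord A j else 0 :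
              MvPolynomial (Fin (n + 1)) A →ₐ[A] SimplexRing A m) := by
        rw [Ideal.span_singleton_le_iff_mem, RingHom.mem_ker]
        simp only [map_sub, map_sum, MvPolynomial.aeval_X, map_one]
        rw [Finset.sum_comm]
        simp [sum_coord]
      exact hle ha)

/-- The change of base ring `A[Δⁿ] → B[Δⁿ]`. -/
def baseMap (B : Type*) [CommRing B] [Algebra A B] (n : ℕ) :
    SimplexRing A n →+* SimplexRing B n :=
  Ideal.quotientMap _ (MvPolynomial.map (algebraMap A B)) (by
    rw [Ideal.span_singleton_le_iff_mem, Ideal.mem_comap]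
    have h : MvPolynomial.map (algebraMap A B)
        (∑ i, MvPolynomial.X i - 1 : MvPolynomial (Fin (n + 1)) A) =
        ∑ i, MvPolynomial.X i - 1 := by
      simp
    rw [h]
    exact Ideal.subset_span rfl)

end SimplexRing

/-! ### Bloch's cycle complex of `Spec A` -/

/-- The irreducible closed subsets (given by their generic points) of codimension `p` in
`Spec A × Δⁿ` that meet every face `Spec A × F` properly, that is, in codimension at least `p`
in `Spec A × F`. -/
def AdmissiblePrime (A : Type*) [CommRing A] (p n : ℕ) : Type _ :=
  {P : PrimeSpectrum (SimplexRing A n) // P.asIdeal.height = p ∧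
    ∀ (m : ℕ) (φ : Fin (m + 1) ↪o Fin (n + 1)) (Q : PrimeSpectrum (SimplexRing A m)),
      P.asIdeal ≤ Q.asIdeal.comap (SimplexRing.pull A φ) → (p : ℕ∞) ≤ Q.asIdeal.height}

/-- The group `z^p(Spec A, n)` of admissible cycles. -/
abbrev AdmissibleCycle (A : Type*) [CommRing A] (p n : ℕ) : Type _ :=
  AdmissiblePrime A p n →₀ ℤ

namespace AdmissibleCycle

variable (A : Type*) [CommRing A]

/-- The multiplicity of the prime `Q` in the cycle of the closed subscheme `V(I)`: the length of
the local ring of `V(I)` at `Q`. -/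
def multiplicity {B : Type*} [CommRing B] (I : Ideal B) (Q : PrimeSpectrum B) : ℕ :=
  (Module.length (Localization.AtPrime Q.asIdeal)
    (Localization.AtPrime Q.asIdeal ⧸
      I.map (algebraMap B (Localization.AtPrime Q.asIdeal)))).toNat

theorem le_of_multiplicity_ne_zero {B : Type*} [CommRing B] {I : Ideal B} {Q : PrimeSpectrum B}
    (h : multiplicity I Q ≠ 0) : I ≤ Q.asIdeal := by
  by_contra hI
  apply h
  obtain ⟨x, hxI, hxQ⟩ := Set.not_subset.1 hI
  have htop : I.map (algebraMap B (Localization.AtPrime Q.asIdeal)) = ⊤ :=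
    Ideal.eq_top_of_isUnit_mem _ (Ideal.mem_map_of_mem _ hxI)
      (IsLocalization.map_units (Localization.AtPrime Q.asIdeal)
        (⟨x, hxQ⟩ : Q.asIdeal.primeCompl))
  have : Subsingleton (Localization.AtPrime Q.asIdeal ⧸
      I.map (algebraMap B (Localization.AtPrime Q.asIdeal))) :=
    Ideal.Quotient.subsingleton_iff.2 htop
  simp [multiplicity, Module.length_eq_zero]

variable [IsNoetherianRing A]

theorem finite_support_face {p n : ℕ} (i : Fin (n + 2)) (P : AdmissiblePrime A p (n + 1)) :
    (Function.support fun Q : AdmissiblePrime A p n =>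
      (multiplicity (P.1.asIdeal.map (SimplexRing.pull A i.succAbove)) Q.1 : ℤ)).Finite := by
  set I := P.1.asIdeal.map (SimplexRing.pull A i.succAbove) with hI
  refine Set.Finite.of_finite_image
    (f := fun Q : AdmissiblePrime A p n => Q.1.asIdeal)
    ((I.finite_minimalPrimes_of_isNoetherianRing _).subset ?_) ?_
  · rintro _ ⟨Q, hQ, rfl⟩
    have hle : I ≤ Q.1.asIdeal :=
      le_of_multiplicity_ne_zero (by simpa using hQ)
    obtain ⟨M, hM, hMQ⟩ := Ideal.exists_minimalPrimes_le hle
    have hMp : M.IsPrime := hM.1.1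
    have hh : (p : ℕ∞) ≤ M.height :=
      P.2.2 n (Fin.succAboveOrderEmb i) ⟨M, hMp⟩ (Ideal.map_le_iff_le_comap.1 hM.1.2)
    rcases hMQ.eq_or_lt with h | h
    · exact Set.mem_of_eq_of_mem h.symm hM
    · exfalso
      have hlt : M.height < Q.1.asIdeal.height := by
        have : Q.1.asIdeal.IsPrime := Q.1.isPrime
        exact Ideal.height_strict_mono_of_isPrime_of_isPrime h
      rw [Q.2.1] at hlt
      exact absurd hh (not_le.2 hlt)
  · intro Q _ Q' _ h
    exact Subtype.ext (PrimeSpectrum.ext h)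

/-- The `i`-th face map `z^p(Spec A, n+1) → z^p(Spec A, n)`, the intersection with the face
`tᵢ = 0`. Since `tᵢ` is a nonzerodivisor on the coordinate ring of an admissible subvariety, the
intersection multiplicities are the lengths of the scheme-theoretic intersection. -/
def face (p n : ℕ) (i : Fin (n + 2)) : AdmissibleCycle A p (n + 1) →+ AdmissibleCycle A p n :=
  Finsupp.liftAddHom fun P => (zmultiplesHom _)
    (Finsupp.ofSupportFinite _ (finite_support_face A i P))

/-- The differential `∑ (-1)ⁱ ∂ᵢ` of Bloch's cycle complex. -/
def differential (p n : ℕ) : AdmissibleCycle A p (n + 1) →+ AdmissibleCycle A p n :=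
  ∑ i : Fin (n + 2), (-1 : ℤ) ^ (i : ℕ) • face A p n i

/-- The kernel of the differential in simplicial degree `n`. -/
def closedCycles (p : ℕ) : (n : ℕ) → AddSubgroup (AdmissibleCycle A p n)
  | 0 => ⊤
  | n + 1 => (differential A p n).ker

/-- A cycle as a finitely supported function on all points of `Spec A × Δⁿ`. -/
def toPoints {A : Type*} [CommRing A] {p n : ℕ} (c : AdmissibleCycle A p n) :
    PrimeSpectrum (SimplexRing A n) →₀ ℤ :=
  c.mapDomain Subtype.val

end AdmissibleCycle

/-- Bloch's higher Chow group `CH^p(Spec A, n)`, the `n`-th homology of the cycle complex. In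
particular `HigherChow A p 0` is the Chow group `CH^p(Spec A)`. -/
abbrev HigherChow (A : Type*) [CommRing A] [IsNoetherianRing A] (p n : ℕ) : Type _ :=
  AdmissibleCycle.closedCycles A p n ⧸
    (AdmissibleCycle.differential A p n).range.addSubgroupOf
      (AdmissibleCycle.closedCycles A p n)

/-! ### The boundary map of the localization sequence -/

section Localization

variable (R : Type*) [CommRing R] [IsDomain R] [IsDiscreteValuationRing R]
  (F : Type*) [Field F] [Algebra R F] [IsFractionRing R F]

/-- For a discrete valuation ring `R` with closed point `v` and generic point `η`, the relation
"`y` is the boundary of `x`" between `x ∈ CH^{p+1}(η, n+1)` and `y ∈ CH^p(v, n)`: the class `x` is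
represented by the restriction `j^* z` to the generic fibre of some `z ∈ z^{p+1}(Spec R, n+1)`
whose differential is the push-forward `i_* w` from the special fibre of a cycle `w` that
represents `y`. -/
def LocalizationRel (p n : ℕ) (x : HigherChow F (p + 1) (n + 1))
    (y : HigherChow (IsLocalRing.ResidueField R) p n) : Prop :=
  ∃ (z : AdmissibleCycle R (p + 1) (n + 1))
    (ξ : AdmissibleCycle.closedCycles F (p + 1) (n + 1))
    (w : AdmissibleCycle.closedCycles (IsLocalRing.ResidueField R) p n),
    x = (ξ : HigherChow F (p + 1) (n + 1)) ∧
    y = (w : HigherChow (IsLocalRing.ResidueField R) p n) ∧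
    (∀ Q : PrimeSpectrum (SimplexRing F (n + 1)),
      ξ.1.toPoints Q =
        z.toPoints (PrimeSpectrum.comap (SimplexRing.baseMap R F (n + 1)) Q)) ∧
    (AdmissibleCycle.differential R (p + 1) n z).toPoints =
      w.1.toPoints.mapDomain
        (PrimeSpectrum.comap (SimplexRing.baseMap R (IsLocalRing.ResidueField R) n))

/-- `bd` is the connecting homomorphism `CH^1(η, 1) → CH^0(v)` of the long exact sequence attached
to `z^0(v, •) → z^1(Spec R, •) → z^1(η, •)`. -/
def IsLocalizationBoundary
    (bd : HigherChow F 1 1 →+ HigherChow (IsLocalRing.ResidueField R) 0 0) : Prop :=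
  ∀ x y, bd x = y ↔ LocalizationRel R F 0 0 x y

/-- The `v`-adic Deligne cohomology `H^1_𝒟(X_{/v}, ℚ(1))` of `X = Spec F` with model `Spec R`. The
special fibre `Y = Spec k(v)` is smooth and irreducible, so `Y^(1) = Y` and `Y^(2) = ∅`, and
`i^* i_* : CH^0(Y) → CH^1(Spec R) → CH^1(Y)` is zero because `Y` is a principal divisor (both groups
on the right even vanish); hence `Ker(i^* i_*) / Im(γ) ⊗ ℚ` is `CH^0(v) ⊗ ℚ`. -/
abbrev DeligneH1 : Type _ :=
  ℚ ⊗[ℤ] HigherChow (IsLocalRing.ResidueField R) 0 0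

/-- The `v`-adic regulator `CH^1(η, 1) → H^1_𝒟(X_{/v}, ℚ(1))` given by the boundary map `bd`. -/
def regulator (bd : HigherChow F 1 1 →+ HigherChow (IsLocalRing.ResidueField R) 0 0) :
    HigherChow F 1 1 →ₗ[ℤ] DeligneH1 R :=
  (TensorProduct.mk ℤ ℚ (HigherChow (IsLocalRing.ResidueField R) 0 0) 1).comp bd.toIntLinearMap

/-- The `ℚ`-linear extension `CH^1(η, 1) ⊗ ℚ → H^1_𝒟(X_{/v}, ℚ(1))` of the regulator. -/
def rationalRegulator (bd : HigherChow F 1 1 →+ HigherChow (IsLocalRing.ResidueField R) 0 0) :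
    (ℚ ⊗[ℤ] HigherChow F 1 1) →ₗ[ℚ] DeligneH1 R :=
  bd.toIntLinearMap.baseChange ℚ

end Localization

/-- A full sublattice of a rational vector space: a finitely generated subgroup that spans it. -/
def IsFullSublattice {V : Type*} [AddCommGroup V] [Module ℚ V] (M : Submodule ℤ V) : Prop :=
  M.FG ∧ Submodule.span ℚ (M : Set V) = ⊤

/-! ### The local `L`-factor of `H^0` -/

section LFactor

/-- `H^0(Spec E, ℚ_ℓ)`: the global sections of the constant sheaf, that is, the locally constant
functions with values in `ℚ_ℓ`. -/
abbrev EllAdicH0 (E : Type*) [CommRing E] (ℓ : ℕ) [Fact ℓ.Prime] : Type _ :=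
  LocallyConstant (PrimeSpectrum E) ℚ_[ℓ]

variable (R : Type*) [CommRing R] [IsDomain R] [IsDiscreteValuationRing R]
  (F : Type*) [Field F] [Algebra R F] [IsFractionRing R F]

/-- The action of the absolute Galois group of `F` on `H^0(X̄, ℚ_ℓ)` for `X = Spec F`. -/
def galoisAction (ℓ : ℕ) [Fact ℓ.Prime]
    (σ : AlgebraicClosure F ≃ₐ[F] AlgebraicClosure F) :
    EllAdicH0 (AlgebraicClosure F) ℓ →ₗ[ℚ_[ℓ]] EllAdicH0 (AlgebraicClosure F) ℓ :=
  LocallyConstant.comapₗ ℚ_[ℓ]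
    ⟨PrimeSpectrum.comap (σ : AlgebraicClosure F →+* AlgebraicClosure F),
      PrimeSpectrum.continuous_comap _⟩

theorem galoisAction_mul (ℓ : ℕ) [Fact ℓ.Prime]
    (σ τ : AlgebraicClosure F ≃ₐ[F] AlgebraicClosure F)
    (f : EllAdicH0 (AlgebraicClosure F) ℓ) :
    galoisAction F ℓ (σ * τ) f = galoisAction F ℓ σ (galoisAction F ℓ τ f) := by
  ext x
  rfl

/-- The nonunits of the integral closure of `R` in the algebraic closure of `F`; if `R` is complete,
these form its maximal ideal. -/
def integralNonunits : Set (AlgebraicClosure F) :=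
  {x | IsIntegral R x ∧ ¬ (x ≠ 0 ∧ IsIntegral R x⁻¹)}

/-- The inertia group: the automorphisms that act trivially on the residue field of the integral
closure of `R`. -/
def inertia : Set (AlgebraicClosure F ≃ₐ[F] AlgebraicClosure F) :=
  {σ | ∀ x, IsIntegral R x → σ x - x ∈ integralNonunits R F}

/-- `σ` is a geometric Frobenius: its inverse acts as `x ↦ x ^ N(v)` on the residue field of the
integral closure of `R`. -/
def IsGeometricFrobenius (σ : AlgebraicClosure F ≃ₐ[F] AlgebraicClosure F) : Prop :=
  ∀ x, IsIntegral R x →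
    σ⁻¹ x - x ^ Nat.card (IsLocalRing.ResidueField R) ∈ integralNonunits R F

variable {F} in
theorem isIntegral_galois_iff (σ : AlgebraicClosure F ≃ₐ[F] AlgebraicClosure F)
    (x : AlgebraicClosure F) : IsIntegral R (σ x) ↔ IsIntegral R x :=
  isIntegral_algEquiv (σ.restrictScalars R)

variable {F} in
theorem galois_mem_integralNonunits (σ : AlgebraicClosure F ≃ₐ[F] AlgebraicClosure F)
    {x : AlgebraicClosure F} (hx : x ∈ integralNonunits R F) : σ x ∈ integralNonunits R F := by
  refine ⟨(isIntegral_galois_iff R σ x).2 hx.1, fun h => hx.2 ⟨?_, ?_⟩⟩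
  · rintro rfl
    exact h.1 (map_zero σ)
  · exact (isIntegral_galois_iff R σ x⁻¹).1 (by simpa using h.2)

/-- The inertia invariants `H^0(X̄, ℚ_ℓ)^I`. -/
def inertiaInvariants (ℓ : ℕ) [Fact ℓ.Prime] :
    Submodule ℚ_[ℓ] (EllAdicH0 (AlgebraicClosure F) ℓ) where
  carrier := {f | ∀ σ ∈ inertia R F, galoisAction F ℓ σ f = f}
  add_mem' hf hg σ hσ := by rw [map_add, hf σ hσ, hg σ hσ]
  zero_mem' σ _ := map_zero _
  smul_mem' c f hf σ hσ := by rw [map_smul, hf σ hσ]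

theorem galoisAction_mem_inertiaInvariants (ℓ : ℕ) [Fact ℓ.Prime]
    (σ : AlgebraicClosure F ≃ₐ[F] AlgebraicClosure F) :
    ∀ f ∈ inertiaInvariants R F ℓ, galoisAction F ℓ σ f ∈ inertiaInvariants R F ℓ := by
  intro f hf τ hτ
  have hconj : σ⁻¹ * τ * σ ∈ inertia R F := by
    intro x hx
    have h := galois_mem_integralNonunits R σ⁻¹
      (hτ (σ x) ((isIntegral_galois_iff R σ x).2 hx))
    have e : σ⁻¹ (τ (σ x) - σ x) = (σ⁻¹ * τ * σ) x - x := by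
      rw [map_sub]
      congr 1
      exact σ.symm_apply_apply x
    rwa [e] at h
  have e : τ * σ = σ * (σ⁻¹ * τ * σ) := by group
  rw [← galoisAction_mul, e, galoisAction_mul, hf _ hconj]

/-- The local `L`-factor `L_v(X, s) = det(1 - σ N(v)^{-s} | H^0(X̄, ℚ_ℓ)^I)⁻¹` of `X = Spec F`, where
`σ` is a geometric Frobenius and the `ℓ`-adic coefficients are carried into `ℂ` by `ι`. -/
def localLFactor (ℓ : ℕ) [Fact ℓ.Prime] (ι : ℚ_[ℓ] →+* ℂ)
    (σ : AlgebraicClosure F ≃ₐ[F] AlgebraicClosure F) (s : ℂ) : ℂ :=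
  letI := ι.toAlgebra
  (LinearMap.det (LinearMap.id -
    ((Nat.card (IsLocalRing.ResidueField R) : ℂ) ^ (-s)) •
      (((galoisAction F ℓ σ).restrict
        (galoisAction_mem_inertiaInvariants R F ℓ σ)).baseChange ℂ)))⁻¹

end LFactor

end

noncomputable section

namespace SimplexRing

variable (A : Type*) [CommRing A]

variable {A} in
theorem ringHom_ext {B : Type*} [Semiring B] {n : ℕ} {f g : SimplexRing A n →+* B}
    (hC : ∀ a : A, f (algebraMap A _ a) = g (algebraMap A _ a))
    (hX : ∀ i, f (coord A i) = g (coord A i)) : f = g :=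
  Ideal.Quotient.ringHom_ext (MvPolynomial.ringHom_ext hC hX)

variable {A} in
theorem algHom_ext {B : Type*} [Semiring B] [Algebra A B] {n : ℕ} {f g : SimplexRing A n →ₐ[A] B}
    (hX : ∀ i, f (coord A i) = g (coord A i)) : f = g :=
  Ideal.Quotient.algHom_ext _ (MvPolynomial.algHom_ext hX)

/-- The map out of the coordinate ring of `Δⁿ` given by elements with sum one. -/
def lift {B : Type*} [CommRing B] [Algebra A B] {n : ℕ} (b : Fin (n + 1) → B) (hb : ∑ i, b i = 1) :
    SimplexRing A n →ₐ[A] B :=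
  Ideal.Quotient.liftₐ _ (MvPolynomial.aeval b) (by
    intro a ha
    have hle : Ideal.span {(∑ i, MvPolynomial.X i - 1 : MvPolynomial (Fin (n + 1)) A)} ≤
        RingHom.ker (MvPolynomial.aeval b : MvPolynomial (Fin (n + 1)) A →ₐ[A] B) := by
      rw [Ideal.span_singleton_le_iff_mem, RingHom.mem_ker]
      simp [hb]
    exact hle ha)

@[simp]
theorem lift_coord {B : Type*} [CommRing B] [Algebra A B] {n : ℕ} (b : Fin (n + 1) → B)
    (hb : ∑ i, b i = 1) (i : Fin (n + 1)) : lift A b hb (coord A i) = b i :=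
  MvPolynomial.aeval_X b i

@[simp]
theorem pull_coord {m n : ℕ} (φ : Fin (m + 1) → Fin (n + 1)) (i : Fin (n + 1)) :
    pull A φ (coord A i) = ∑ j, if φ j = i then coord A j else 0 :=
  MvPolynomial.aeval_X _ i

section baseMap

variable (B : Type*) [CommRing B] [Algebra A B] (n : ℕ)

@[simp]
theorem baseMap_coord (i : Fin (n + 1)) : baseMap A B n (coord A i) = coord B i := by
  simp [baseMap, coord]

@[simp]
theorem baseMap_algebraMap (a : A) :
    baseMap A B n (algebraMap A _ a) = algebraMap B _ (algebraMap A B a) := by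
  change Ideal.quotientMap _ _ _ (Ideal.Quotient.mk _ (MvPolynomial.C a)) = _
  rw [Ideal.quotientMap_mk, MvPolynomial.map_C]
  rfl

end baseMap

/-- The value at the `j`-th vertex of `Δⁿ`. -/
def vertex {n : ℕ} (j : Fin (n + 1)) : SimplexRing A n →ₐ[A] A :=
  lift A (Pi.single j 1) (by simp)

@[simp]
theorem vertex_coord {n : ℕ} (i j : Fin (n + 1)) :
    vertex A j (coord A i) = if i = j then 1 else 0 := by
  simp [vertex, Pi.single_apply]

variable {A} in
@[simp]
theorem vertex_pull {m n : ℕ} (φ : Fin (m + 1) → Fin (n + 1)) (j : Fin (m + 1))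
    (x : SimplexRing A n) : vertex A j (pull A φ x) = vertex A (φ j) x := by
  have : (vertex A j).comp (pull A φ) = vertex A (φ j) := by
    refine algHom_ext fun i => ?_
    rw [AlgHom.comp_apply, pull_coord, map_sum, Finset.sum_eq_single j]
    · simp [apply_ite (vertex A j), eq_comm]
    · intro k _ hk
      simp [apply_ite (vertex A j), hk]
    · simp
  exact DFunLike.congr_fun this x

variable {A} in
@[simp]
theorem vertex_baseMap {B : Type*} [CommRing B] [Algebra A B] {n : ℕ} (j : Fin (n + 1))
    (x : SimplexRing A n) : vertex B j (baseMap A B n x) = algebraMap A B (vertex A j x) := by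
  have : ((vertex B j : SimplexRing B n →+* B).comp (baseMap A B n)) =
      (algebraMap A B).comp (vertex A j : SimplexRing A n →+* A) := by
    refine ringHom_ext (fun a => ?_) fun i => ?_
    · simp
    · simp [apply_ite (algebraMap A B)]
  exact DFunLike.congr_fun this x

variable {A} in
theorem algebraMap_vertex_zero (x : SimplexRing A 0) : algebraMap A _ (vertex A 0 x) = x := by
  have : (Algebra.ofId A (SimplexRing A 0)).comp (vertex A 0) = AlgHom.id A _ := by
    refine algHom_ext fun i => ?_
    have h : coord A (0 : Fin (0 + 1)) = 1 :=
      (Fin.sum_univ_one (coord A)).symm.trans (sum_coord A 0)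
    obtain rfl : i = 0 := Fin.fin_one_eq_zero i
    simp [h]
  exact DFunLike.congr_fun this x

variable {A} in
theorem ne_zero_of_vertex_ne_zero {n : ℕ} {f : SimplexRing A n} {j : Fin (n + 1)} (h : vertex A j f ≠ 0) :
    f ≠ 0 := by
  rintro rfl
  exact h (map_zero _)

variable {A} in
theorem pull_ne_zero {m n : ℕ} {f : SimplexRing A n} (h : ∀ j, vertex A j f ≠ 0)
    (φ : Fin (m + 1) → Fin (n + 1)) : pull A φ f ≠ 0 :=
  ne_zero_of_vertex_ne_zero (j := 0) (by rw [vertex_pull]; exact h _)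

/-- The algebraic `0`-simplex is the base. -/
def equivZero : SimplexRing A 0 ≃+* A :=
  RingEquiv.ofRingHom (vertex A (0 : Fin (0 + 1))).toRingHom (algebraMap A _)
    (by ext; simp) (RingHom.ext fun x => algebraMap_vertex_zero x)

/-- The algebraic simplex is an affine space. -/
def equivMvPolynomial (n : ℕ) : SimplexRing A n ≃ₐ[A] MvPolynomial (Fin n) A :=
  AlgEquiv.ofAlgHom
    (lift A (Fin.cons (1 - ∑ i, MvPolynomial.X i) MvPolynomial.X) (by simp [Fin.sum_univ_succ]))
    (MvPolynomial.aeval fun i => coord A i.succ)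
    (by
      refine MvPolynomial.algHom_ext fun i => ?_
      simp)
    (by
      refine algHom_ext fun i => ?_
      refine Fin.cases ?_ (fun i => ?_) i
      · have h := sum_coord A n
        rw [Fin.sum_univ_succ, ← eq_sub_iff_add_eq] at h
        simp [h]
      · simp)

theorem equivMvPolynomial_baseMap (B : Type*) [CommRing B] [Algebra A B] (n : ℕ)
    (x : SimplexRing A n) :
    equivMvPolynomial B n (baseMap A B n x) =
      MvPolynomial.map (algebraMap A B) (equivMvPolynomial A n x) := by
  have : (equivMvPolynomial B n).toAlgHom.toRingHom.comp (baseMap A B n) =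
      (MvPolynomial.map (algebraMap A B)).comp (equivMvPolynomial A n).toAlgHom.toRingHom := by
    refine ringHom_ext (fun a => ?_) fun i => ?_
    · simp [MvPolynomial.algebraMap_eq]
    · refine Fin.cases ?_ (fun i => ?_) i <;> simp [equivMvPolynomial]
  exact DFunLike.congr_fun this x

variable {A} in
/-- Units on an algebraic simplex over a domain are constant. -/
theorem vertex_eq_of_isUnit [IsDomain A] {n : ℕ} {u : SimplexRing A n} (hu : IsUnit u)
    (i j : Fin (n + 1)) : vertex A i u = vertex A j u := by
  obtain ⟨a, -, ha⟩ := MvPolynomial.isUnit_iff_eq_C_of_isReduced.1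
    (hu.map (equivMvPolynomial A n))
  have : u = algebraMap A _ a := by
    apply (equivMvPolynomial A n).injective
    rw [ha, AlgEquiv.commutes]
    rfl
  simp [this]

instance [IsDomain A] (n : ℕ) : IsDomain (SimplexRing A n) :=
  (equivMvPolynomial A n).toMulEquiv.isDomain _

instance [IsDomain A] [UniqueFactorizationMonoid A] (n : ℕ) :
    UniqueFactorizationMonoid (SimplexRing A n) :=
  (equivMvPolynomial A n).symm.toMulEquiv.uniqueFactorizationMonoid inferInstance

/-- Extension of scalars to a localization is a localization of coordinate rings. -/
theorem isLocalization_baseMap (M : Submonoid A) (B : Type*) [CommRing B] [Algebra A B]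
    [IsLocalization M B] (n : ℕ) :
    letI := (baseMap A B n).toAlgebra
    IsLocalization (M.map (algebraMap A (SimplexRing A n))) (SimplexRing B n) := by
  let := (baseMap A B n).toAlgebra
  have hC (a : A) : equivMvPolynomial A n (algebraMap A _ a) = MvPolynomial.C a :=
    (equivMvPolynomial A n).commutes a
  let := MvPolynomial.algebraMvPolynomial (R := A) (S := B) (σ := Fin n)
  have hloc : IsLocalization (M.map (MvPolynomial.C (σ := Fin n))) (MvPolynomial (Fin n) B) :=
    inferInstance
  refine ⟨?_, fun z => ?_, fun {x y} h => ?_⟩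
  · rintro ⟨_, a, ha, rfl⟩
    change IsUnit (baseMap A B n (algebraMap A _ a))
    rw [baseMap_algebraMap]
    exact (IsLocalization.map_units B ⟨a, ha⟩).map _
  · obtain ⟨⟨x, _, a, ha, rfl⟩, h⟩ :=
      IsLocalization.surj (M.map (MvPolynomial.C (σ := Fin n))) (equivMvPolynomial B n z)
    refine ⟨⟨(equivMvPolynomial A n).symm x, _, a, ha, rfl⟩, ?_⟩
    apply (equivMvPolynomial B n).injective
    change equivMvPolynomial B n (z * baseMap A B n (algebraMap A _ a)) =
      equivMvPolynomial B n (baseMap A B n _)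
    rw [map_mul, equivMvPolynomial_baseMap, equivMvPolynomial_baseMap, AlgEquiv.apply_symm_apply,
      hC]
    exact h
  · change baseMap A B n x = baseMap A B n y at h
    have h' := congrArg (equivMvPolynomial B n) h
    rw [equivMvPolynomial_baseMap, equivMvPolynomial_baseMap] at h'
    obtain ⟨⟨_, a, ha, rfl⟩, h⟩ := hloc.exists_of_eq h'
    refine ⟨⟨_, a, ha, rfl⟩, (equivMvPolynomial A n).injective ?_⟩
    change equivMvPolynomial A n (algebraMap A _ a * x) = equivMvPolynomial A n (_ * y)
    rw [map_mul, map_mul, hC]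
    exact h

end SimplexRing

/-! ### Multiplicities of principal ideals -/

namespace AdmissibleCycle

section multiplicity

variable {B : Type*} [CommRing B]

theorem multiplicity_self (Q : PrimeSpectrum B) : multiplicity Q.asIdeal Q = 1 := by
  rw [multiplicity, Localization.AtPrime.map_eq_maximalIdeal]
  have : IsSimpleModule (Localization.AtPrime Q.asIdeal) (Localization.AtPrime Q.asIdeal ⧸
      IsLocalRing.maximalIdeal (Localization.AtPrime Q.asIdeal)) :=
    isSimpleModule_iff_isCoatom.2 (IsLocalRing.maximalIdeal.isMaximal _).1
  rw [Module.length_eq_one]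
  rfl

theorem multiplicity_span_singleton (f : B) (Q : PrimeSpectrum B) :
    multiplicity (Ideal.span {f}) Q =
      (Ring.ord (Localization.AtPrime Q.asIdeal) (algebraMap _ _ f)).toNat := by
  rw [multiplicity, Ideal.map_span, Set.image_singleton]
  rfl

theorem multiplicity_eq_zero {f : B} {Q : PrimeSpectrum B} (h : f ∉ Q.asIdeal) :
    multiplicity (Ideal.span {f}) Q = 0 := by
  by_contra h0
  exact h (le_of_multiplicity_ne_zero h0 (Ideal.mem_span_singleton_self f))

theorem multiplicity_span_mul [IsDomain B] [IsNoetherianRing B] {f g : B} (hf : f ≠ 0)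
    (hg : g ≠ 0) {Q : PrimeSpectrum B} (hQ : Q.asIdeal.height ≤ 1) :
    multiplicity (Ideal.span {f * g}) Q =
      multiplicity (Ideal.span {f}) Q + multiplicity (Ideal.span {g}) Q := by
  have hdim : Ring.KrullDimLE 1 (Localization.AtPrime Q.asIdeal) := by
    rw [Ring.krullDimLE_iff, IsLocalization.AtPrime.ringKrullDim_eq_height Q.asIdeal]
    exact_mod_cast hQ
  have hinj : Function.Injective (algebraMap B (Localization.AtPrime Q.asIdeal)) :=
    IsLocalization.injective _ Q.asIdeal.primeCompl_le_nonZeroDivisors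
  have hne {x : B} (hx : x ≠ 0) :
      algebraMap B (Localization.AtPrime Q.asIdeal) x ∈
        nonZeroDivisors (Localization.AtPrime Q.asIdeal) :=
    mem_nonZeroDivisors_of_ne_zero ((map_ne_zero_iff _ hinj).2 hx)
  simp only [multiplicity_span_singleton, map_mul]
  rw [Ring.ord_mul _ (hne hg), ENat.toNat_add (Ring.ord_ne_top (hne hf)) (Ring.ord_ne_top (hne hg))]

end multiplicity

end AdmissibleCycle

/-! ### Admissible cycles of codimension one -/

namespace AdmissiblePrime

open SimplexRing

variable {A : Type*} [CommRing A] {n : ℕ}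

theorem height_eq_one (P : AdmissiblePrime A 1 n) : P.1.asIdeal.height = 1 := by
  simpa using P.2.1

variable [IsDomain A]

theorem not_le_ker_vertex (P : AdmissiblePrime A 1 n) (j : Fin (n + 1)) :
    ¬ P.1.asIdeal ≤ RingHom.ker (vertex A j) := by
  intro h
  let φ : Fin (0 + 1) ↪o Fin (n + 1) :=
    { toFun := fun _ => j
      inj' := fun a b _ => Subsingleton.elim (α := Fin 1) a b
      map_rel_iff' := fun {a b} => by simp [Subsingleton.elim (α := Fin 1) a b] }
  have h1 := P.2.2 0 φ ⟨⊥, Ideal.isPrime_bot⟩ fun f hf => by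
    have hφ : φ 0 = j := rfl
    rw [Ideal.mem_comap, Ideal.mem_bot, ← algebraMap_vertex_zero (pull A φ f), vertex_pull, hφ,
      (h hf : vertex A j f = 0), map_zero]
  simp at h1

theorem vertex_ne_zero (P : AdmissiblePrime A 1 n) {f : SimplexRing A n}
    (hf : P.1.asIdeal = Ideal.span {f}) (j : Fin (n + 1)) : vertex A j f ≠ 0 := by
  intro h
  apply P.not_le_ker_vertex j
  rwa [hf, Ideal.span_singleton_le_iff_mem]

/-- A point of codimension one is admissible if it does not specialize to the vertices. -/
def ofVertex (P : PrimeSpectrum (SimplexRing A n)) (hP : P.asIdeal.height = 1)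
    (h : ∀ j, ¬ P.asIdeal ≤ RingHom.ker (vertex A j)) : AdmissiblePrime A 1 n :=
  ⟨P, by simpa using hP, fun m φ Q hQ => by
    rw [Nat.cast_one, Order.one_le_iff_ne_zero]
    intro h0
    rw [Ideal.height_eq_zero_iff_eq_bot] at h0
    refine h (φ 0) fun f hf => ?_
    have := hQ hf
    rw [h0, Ideal.mem_comap, Ideal.mem_bot] at this
    rw [RingHom.mem_ker, ← vertex_pull, this, map_zero]⟩

/-- The point of codimension one given by a prime element that vanishes at no vertex. -/
def ofPrime [IsNoetherianRing A] (f : SimplexRing A n) (hf : Prime f)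
    (h : ∀ j, vertex A j f ≠ 0) : AdmissiblePrime A 1 n :=
  ofVertex ⟨Ideal.span {f}, (Ideal.span_singleton_prime hf.ne_zero).2 hf⟩
    (Ideal.height_span_singleton_eq_one_of_mem_nonZeroDivisors
      (mem_nonZeroDivisors_of_ne_zero hf.ne_zero) hf.not_isUnit)
    fun j hj => h j (hj (Ideal.mem_span_singleton_self f))

theorem exists_generator [UniqueFactorizationMonoid A] (P : AdmissiblePrime A 1 n) :
    ∃ f, Prime f ∧ P.1.asIdeal = Ideal.span {f} := by
  have := P.1.isPrime
  obtain ⟨f, hf⟩ := UniqueFactorizationMonoid.isPrincipal_of_height_eq_one P.height_eq_one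
  have hf' : P.1.asIdeal = Ideal.span {f} := hf
  refine ⟨f, ?_, hf'⟩
  rw [← Ideal.span_singleton_prime, ← hf']
  · exact P.1.isPrime
  · rintro rfl
    exact P.1.asIdeal.ne_bot_of_height_eq_one P.height_eq_one (by simp [hf'])

/-- A generator of the ideal of an admissible subvariety of codimension one. -/
def generator [UniqueFactorizationMonoid A] (P : AdmissiblePrime A 1 n) : SimplexRing A n :=
  P.exists_generator.choose

theorem asIdeal_eq_span_generator [UniqueFactorizationMonoid A] (P : AdmissiblePrime A 1 n) :
    P.1.asIdeal = Ideal.span {P.generator} :=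
  P.exists_generator.choose_spec.2

end AdmissiblePrime

namespace AdmissibleCycle

open SimplexRing

variable {A : Type*} [CommRing A] [IsNoetherianRing A] {n : ℕ}

theorem face_single_apply (p : ℕ) (i : Fin (n + 2)) (P : AdmissiblePrime A p (n + 1))
    (Q : AdmissiblePrime A p n) :
    face A p n i (Finsupp.single P 1) Q =
      multiplicity (P.1.asIdeal.map (pull A i.succAbove)) Q.1 := by
  simp only [face, Finsupp.liftAddHom_apply_single, zmultiplesHom_apply, one_smul]
  rfl

variable [IsDomain A]

theorem finite_support_multiplicity {f : SimplexRing A n} (hf : f ≠ 0) :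
    (Function.support fun Q : AdmissiblePrime A 1 n =>
      (multiplicity (Ideal.span {f}) Q.1 : ℤ)).Finite := by
  refine Set.Finite.of_finite_image (f := fun Q : AdmissiblePrime A 1 n => Q.1.asIdeal)
    (((Ideal.span {f}).finite_minimalPrimes_of_isNoetherianRing _).subset ?_) ?_
  · rintro _ ⟨Q, hQ, rfl⟩
    have hle : Ideal.span {f} ≤ Q.1.asIdeal := le_of_multiplicity_ne_zero (by simpa using hQ)
    have := Q.1.isPrime
    refine Ideal.mem_minimalPrimes_of_height_le hle ?_
    rw [Q.height_eq_one]
    exact Ideal.one_le_height_span_singleton_of_mem_nonZeroDivisors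
      (mem_nonZeroDivisors_of_ne_zero hf)
  · intro Q _ Q' _ h
    exact Subtype.ext (PrimeSpectrum.ext h)

/-- The divisor of a nonzero function, restricted to the admissible points. -/
def divisor (f : SimplexRing A n) (hf : f ≠ 0) : AdmissibleCycle A 1 n :=
  Finsupp.ofSupportFinite _ (finite_support_multiplicity hf)

@[simp]
theorem divisor_apply (f : SimplexRing A n) (hf : f ≠ 0) (Q : AdmissiblePrime A 1 n) :
    divisor f hf Q = multiplicity (Ideal.span {f}) Q.1 :=
  rfl

theorem divisor_of_isUnit {f : SimplexRing A n} (hf : IsUnit f) :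
    divisor f hf.ne_zero = 0 := by
  ext Q
  rw [divisor_apply, multiplicity_eq_zero, Nat.cast_zero, Finsupp.zero_apply]
  exact fun h => Q.1.isPrime.ne_top (Ideal.eq_top_of_isUnit_mem _ h hf)

theorem divisor_mul {f g : SimplexRing A n} (hf : f ≠ 0) (hg : g ≠ 0) :
    divisor (f * g) (mul_ne_zero hf hg) = divisor f hf + divisor g hg := by
  ext Q
  simp [multiplicity_span_mul hf hg Q.height_eq_one.le]

theorem divisor_eq_single (P : AdmissiblePrime A 1 n) {f : SimplexRing A n} (hf : f ≠ 0)
    (hP : P.1.asIdeal = Ideal.span {f}) : divisor f hf = Finsupp.single P 1 := by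
  classical
  ext Q
  rw [divisor_apply, Finsupp.single_apply]
  split_ifs with h
  · subst h
    rw [← hP, multiplicity_self, Nat.cast_one]
  · rw [multiplicity_eq_zero, Nat.cast_zero]
    intro hfQ
    apply h
    have hle : P.1.asIdeal ≤ Q.1.asIdeal := by
      rwa [hP, Ideal.span_singleton_le_iff_mem]
    refine Subtype.ext (PrimeSpectrum.ext (hle.eq_or_lt.resolve_right fun hlt => ?_))
    have := P.1.isPrime
    have := Q.1.isPrime
    have := Ideal.height_strict_mono_of_isPrime_of_isPrime hlt
    rw [P.height_eq_one, Q.height_eq_one] at this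
    exact lt_irrefl _ this

theorem face_single (i : Fin (n + 2)) (P : AdmissiblePrime A 1 (n + 1))
    {f : SimplexRing A (n + 1)} (hf : P.1.asIdeal = Ideal.span {f}) :
    face A 1 n i (Finsupp.single P 1) =
      divisor (pull A i.succAbove f) (pull_ne_zero (P.vertex_ne_zero hf) _) := by
  ext Q
  rw [face_single_apply, divisor_apply, hf, Ideal.map_span, Set.image_singleton]

/-! ### The order of the quotient of the values at the ends of `Δ¹` -/

section vertexOrder

theorem log_map_mul {A : Type*} [MulZeroOneClass A] {w : A →*₀ WithZero (Multiplicative ℤ)}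
    (hw : ∀ a, a ≠ 0 → w a ≠ 0) {a b : A} (ha : a ≠ 0) (hb : b ≠ 0) :
    WithZero.log (w (a * b)) = WithZero.log (w a) + WithZero.log (w b) := by
  rw [map_mul, WithZero.log_mul (hw a ha) (hw b hb)]

variable [UniqueFactorizationMonoid A] (w : A →*₀ WithZero (Multiplicative ℤ))

/-- The difference of the orders at the two ends of `Δ¹` of an equation of a divisor on `Δ¹`. -/
def vertexOrder : AdmissibleCycle A 1 1 →+ ℤ :=
  Finsupp.liftAddHom fun P => zmultiplesHom _
    (WithZero.log (w (vertex A 1 P.generator)) - WithZero.log (w (vertex A 0 P.generator)))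

variable {w}

theorem vertexOrder_single (hw : ∀ a, a ≠ 0 → w a ≠ 0) (P : AdmissiblePrime A 1 1)
    {f : SimplexRing A 1} (hf : P.1.asIdeal = Ideal.span {f}) :
    vertexOrder w (Finsupp.single P 1) =
      WithZero.log (w (vertex A 1 f)) - WithZero.log (w (vertex A 0 f)) := by
  have h : Associated P.generator f := by
    rw [← Ideal.span_singleton_eq_span_singleton, ← hf, P.asIdeal_eq_span_generator]
  obtain ⟨u, rfl⟩ := h
  have hg := P.vertex_ne_zero P.asIdeal_eq_span_generator
  have hu (j : Fin 2) : vertex A j (u : SimplexRing A 1) ≠ 0 := (u.isUnit.map (vertex A j)).ne_zero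
  rw [map_mul (vertex A 1), map_mul (vertex A 0), log_map_mul hw (hg 1) (hu 1), log_map_mul hw (hg 0) (hu 0),
    vertex_eq_of_isUnit u.isUnit 1 0]
  simp [vertexOrder]

theorem vertexOrder_divisor (hw : ∀ a, a ≠ 0 → w a ≠ 0) (f : SimplexRing A 1)
    (hf : ∀ j, vertex A j f ≠ 0) :
    vertexOrder w (divisor f (ne_zero_of_vertex_ne_zero (hf 0))) =
      WithZero.log (w (vertex A 1 f)) - WithZero.log (w (vertex A 0 f)) := by
  induction f using UniqueFactorizationMonoid.induction_on_prime with
  | h₁ => exact absurd (map_zero _) (hf 0)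
  | h₂ u hu => rw [divisor_of_isUnit hu, map_zero, vertex_eq_of_isUnit hu 1 0, sub_self]
  | h₃ a p ha hp ih =>
    have hpv (j) : vertex A j p ≠ 0 := fun h => hf j (by rw [map_mul, h, zero_mul])
    have hav (j) : vertex A j a ≠ 0 := fun h => hf j (by rw [map_mul, h, mul_zero])
    rw [divisor_mul hp.ne_zero ha, map_add, ih hav,
      divisor_eq_single (AdmissiblePrime.ofPrime p hp hpv) hp.ne_zero rfl,
      vertexOrder_single hw (AdmissiblePrime.ofPrime p hp hpv) rfl, map_mul (vertex A 1),
      map_mul (vertex A 0), log_map_mul hw (hpv 1) (hav 1), log_map_mul hw (hpv 0) (hav 0)]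
    ring

theorem vertexOrder_differential (hw : ∀ a, a ≠ 0 → w a ≠ 0) (z : AdmissibleCycle A 1 2) :
    vertexOrder w (differential A 1 1 z) = 0 := by
  suffices h : (vertexOrder w).comp (differential A 1 1) = 0 from DFunLike.congr_fun h z
  refine Finsupp.addHom_ext' fun P => AddMonoidHom.ext_int ?_
  have hf := P.asIdeal_eq_span_generator
  have hv := P.vertex_ne_zero hf
  have hface (i : Fin 3) : vertexOrder w (face A 1 1 i (Finsupp.single P 1)) =
      WithZero.log (w (vertex A (i.succAbove 1) P.generator)) -
        WithZero.log (w (vertex A (i.succAbove 0) P.generator)) := by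
    rw [face_single i P hf, vertexOrder_divisor hw _ fun j => by rw [vertex_pull]; exact hv _,
      vertex_pull, vertex_pull]
  have h00 : (0 : Fin 3).succAbove 0 = 1 := rfl
  have h01 : (0 : Fin 3).succAbove 1 = 2 := rfl
  have h10 : (1 : Fin 3).succAbove 0 = 0 := rfl
  have h11 : (1 : Fin 3).succAbove 1 = 2 := rfl
  have h20 : (2 : Fin 3).succAbove 0 = 0 := rfl
  have h21 : (2 : Fin 3).succAbove 1 = 1 := rfl
  simp [differential, Fin.sum_univ_three, hface, h00, h01, h10, h11, h20, h21]

end vertexOrder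

end AdmissibleCycle

/-! ### Cycles of codimension zero -/

section CodimensionZero

variable (A : Type*) [CommRing A] [IsDomain A]

instance (n : ℕ) : Unique (AdmissiblePrime A 0 n) where
  default := ⟨⟨⊥, Ideal.isPrime_bot⟩, by simp, by simp⟩
  uniq P := Subtype.ext (PrimeSpectrum.ext (Ideal.height_eq_zero_iff_eq_bot.1 (by
    simpa using P.2.1)))

theorem AdmissiblePrime.default_asIdeal (n : ℕ) :
    (default : AdmissiblePrime A 0 n).1.asIdeal = ⊥ :=
  rfl

variable [IsNoetherianRing A]

theorem AdmissibleCycle.differential_codim_zero : differential A 0 0 = 0 := by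
  refine Finsupp.addHom_ext' fun P => AddMonoidHom.ext_int ?_
  obtain rfl := Subsingleton.elim P default
  ext
  simp [differential, Fin.sum_univ_two, face_single_apply, AdmissiblePrime.default_asIdeal,
    Ideal.map_bot]

/-- The Chow group of cycles of codimension zero on the spectrum of a domain is infinite cyclic. -/
def HigherChow.degree : HigherChow A 0 0 ≃+ ℤ :=
  AddEquiv.ofBijective
    (QuotientAddGroup.lift _
      ((Finsupp.applyAddHom default).comp (AdmissibleCycle.closedCycles A 0 0).subtype) (by
        rintro c ⟨b, hb⟩
        have hc : c = 0 := by
          ext1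
          simpa [AdmissibleCycle.differential_codim_zero] using hb.symm
        simp [hc])) (by
    refine ⟨?_, fun m => ⟨QuotientAddGroup.mk ⟨Finsupp.single default m, trivial⟩, ?_⟩⟩
    · rw [injective_iff_map_eq_zero]
      intro x hx
      induction x using QuotientAddGroup.induction_on with
      | H c =>
        have hc : c = 0 := Subtype.ext (Finsupp.unique_ext hx)
        rw [hc, QuotientAddGroup.mk_zero]
    · change Finsupp.single default m default = m
      simp)

end CodimensionZero

/-! ### Divisors on the spectrum of a field -/

section Field

variable (k : Type*) [Field k]

instance : IsEmpty (AdmissiblePrime k 1 0) where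
  false P := by
    obtain ⟨f, hf, hP⟩ := P.exists_generator
    apply hf.not_isUnit
    rw [← SimplexRing.algebraMap_vertex_zero f]
    exact (IsUnit.mk0 _ (P.vertex_ne_zero hP 0)).map _

instance : Subsingleton (HigherChow k 1 0) :=
  Function.Surjective.subsingleton (QuotientAddGroup.mk_surjective)

theorem AdmissibleCycle.closedCycles_field : closedCycles k 1 1 = ⊤ := by
  rw [eq_top_iff]
  intro c _
  exact Subsingleton.elim _ _

end Field

/-! ### Divisors on the spectrum of a discrete valuation ring -/

section DiscreteValuationRing

open AdmissibleCycle SimplexRing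

theorem SimplexRing.prime_algebraMap {A : Type*} [CommRing A] {a : A} (ha : Prime a) (n : ℕ) :
    Prime (algebraMap A (SimplexRing A n) a) := by
  rw [← MulEquiv.prime_iff (equivMvPolynomial A n)]
  have : equivMvPolynomial A n (algebraMap A _ a) = MvPolynomial.C a :=
    (equivMvPolynomial A n).commutes a
  rw [this]
  exact (MvPolynomial.prime_C_iff (Fin n)).2 ha

variable (R : Type*) [CommRing R] [IsDomain R] [IsDiscreteValuationRing R]

/-- The closed point of the spectrum of a discrete valuation ring, as a point of `Δ⁰`. -/
abbrev closedSimplexPoint : PrimeSpectrum (SimplexRing R 0) :=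
  PrimeSpectrum.comap (baseMap R (IsLocalRing.ResidueField R) 0)
    (default : AdmissiblePrime (IsLocalRing.ResidueField R) 0 0).1

variable {R} in
theorem mem_closedSimplexPoint {x : SimplexRing R 0} :
    x ∈ (closedSimplexPoint R).asIdeal ↔ vertex R 0 x ∈ IsLocalRing.maximalIdeal R := by
  have hinj : Function.Injective
      (vertex (IsLocalRing.ResidueField R) (0 : Fin (0 + 1))) :=
    (equivZero (IsLocalRing.ResidueField R)).injective
  rw [PrimeSpectrum.comap_asIdeal, Ideal.mem_comap, AdmissiblePrime.default_asIdeal, Ideal.mem_bot,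
    ← map_eq_zero_iff _ hinj, vertex_baseMap]
  exact IsLocalRing.residue_eq_zero_iff _

variable {R} in
theorem closedSimplexPoint_eq_span {π : R} (hπ : Irreducible π) :
    (closedSimplexPoint R).asIdeal = Ideal.span {algebraMap R _ π} := by
  ext x
  rw [mem_closedSimplexPoint, hπ.maximalIdeal_eq, Ideal.mem_span_singleton,
    Ideal.mem_span_singleton]
  constructor
  · rintro ⟨y, hy⟩
    exact ⟨algebraMap R _ y, by rw [← map_mul, ← hy, algebraMap_vertex_zero]⟩
  · rintro ⟨y, rfl⟩
    simp

instance : Unique (AdmissiblePrime R 1 0) where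
  default := AdmissiblePrime.ofVertex (closedSimplexPoint R) (by
      obtain ⟨π, hπ⟩ := IsDiscreteValuationRing.exists_irreducible R
      have hp := prime_algebraMap hπ.prime 0
      rw [closedSimplexPoint_eq_span hπ]
      exact Ideal.height_span_singleton_eq_one_of_mem_nonZeroDivisors
        (mem_nonZeroDivisors_of_ne_zero hp.ne_zero) hp.not_isUnit) (by
      intro j hj
      obtain ⟨π, hπ⟩ := IsDiscreteValuationRing.exists_irreducible R
      rw [closedSimplexPoint_eq_span hπ, Ideal.span_singleton_le_iff_mem, RingHom.mem_ker] at hj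
      exact hπ.ne_zero (by simpa using hj))
  uniq P := by
    refine Subtype.ext (PrimeSpectrum.ext ?_)
    have hP : P.1.asIdeal.comap (algebraMap R _) = IsLocalRing.maximalIdeal R := by
      have := P.1.isPrime
      have hprime : (P.1.asIdeal.comap (algebraMap R _)).IsPrime := Ideal.comap_isPrime _ _
      refine IsLocalRing.eq_maximalIdeal (hprime.isMaximal ?_)
      obtain ⟨x, hx, hx0⟩ := Submodule.exists_mem_ne_zero_of_ne_bot
        (P.1.asIdeal.ne_bot_of_height_eq_one P.height_eq_one)
      rw [Submodule.ne_bot_iff]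
      refine ⟨vertex R 0 x, ?_, ?_⟩
      · rwa [Ideal.mem_comap, algebraMap_vertex_zero]
      · intro h
        apply hx0
        rw [← algebraMap_vertex_zero x, h, map_zero]
    ext x
    change _ ↔ x ∈ (closedSimplexPoint R).asIdeal
    rw [mem_closedSimplexPoint, ← hP, Ideal.mem_comap, algebraMap_vertex_zero]

theorem AdmissiblePrime.default_val :
    (default : AdmissiblePrime R 1 0).1 = closedSimplexPoint R :=
  rfl

theorem log_ordMonoidWithZeroHom_of_irreducible {π : R} (hπ : Irreducible π) :
    WithZero.log (Ring.ordMonoidWithZeroHom R π) = 1 := by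
  rw [Ring.ordMonoidWithZeroHom_eq_coe R (n := 1) (mem_nonZeroDivisors_of_ne_zero hπ.ne_zero)
    (by simpa using Ring.ord_of_irreducible hπ)]
  rfl

theorem ordMonoidWithZeroHom_ne_zero_of_ne_zero (r : R) (hr : r ≠ 0) :
    Ring.ordMonoidWithZeroHom R r ≠ 0 :=
  Ring.ordMonoidWithZeroHom_ne_zero (mem_nonZeroDivisors_of_ne_zero hr)

variable {R} in
theorem multiplicity_closedSimplexPoint (r : R) (hr : r ≠ 0) :
    (AdmissibleCycle.multiplicity (Ideal.span {algebraMap R (SimplexRing R 0) r}) (closedSimplexPoint R) : ℤ) =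
      WithZero.log (Ring.ordMonoidWithZeroHom R r) := by
  have hinj : Function.Injective (algebraMap R (SimplexRing R 0)) :=
    (equivZero R).symm.injective
  induction r using UniqueFactorizationMonoid.induction_on_prime with
  | h₁ => exact absurd rfl hr
  | h₂ u hu =>
    rw [AdmissibleCycle.multiplicity_eq_zero, Ring.ordMonoidWithZeroHom_eq_coe R (n := 0)
      (mem_nonZeroDivisors_of_ne_zero hr) (by simpa using Ring.ord_of_isUnit hu)]
    · rfl
    · exact fun h => (closedSimplexPoint R).isPrime.ne_top
        (Ideal.eq_top_of_isUnit_mem _ h (hu.map _))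
  | h₃ a p ha hp ih =>
    rw [log_map_mul (ordMonoidWithZeroHom_ne_zero_of_ne_zero R) hp.ne_zero ha, ← ih ha,
      log_ordMonoidWithZeroHom_of_irreducible R hp.irreducible, map_mul,
      multiplicity_span_mul (Q := closedSimplexPoint R) ((map_ne_zero_iff _ hinj).2 hp.ne_zero)
        ((map_ne_zero_iff _ hinj).2 ha) (default : AdmissiblePrime R 1 0).height_eq_one.le,
      ← closedSimplexPoint_eq_span hp.irreducible, AdmissibleCycle.multiplicity_self]
    simp

theorem differential_apply_default (z : AdmissibleCycle R 1 1) :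
    differential R 1 0 z default = vertexOrder (Ring.ordMonoidWithZeroHom R) z := by
  suffices h : (Finsupp.applyAddHom default).comp (differential R 1 0) =
      vertexOrder (Ring.ordMonoidWithZeroHom R) from DFunLike.congr_fun h z
  refine Finsupp.addHom_ext' fun P => AddMonoidHom.ext_int ?_
  have hf := P.asIdeal_eq_span_generator
  have hface (i : Fin 2) : face R 1 0 i (Finsupp.single P 1) default =
      WithZero.log (Ring.ordMonoidWithZeroHom R (vertex R (i.succAbove 0) P.generator)) := by
    rw [face_single i P hf, divisor_apply, ← algebraMap_vertex_zero (pull R _ _), vertex_pull]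
    exact multiplicity_closedSimplexPoint _ (P.vertex_ne_zero hf _)
  have h0 : (0 : Fin 2).succAbove 0 = 1 := rfl
  have h1 : (1 : Fin 2).succAbove 0 = 0 := rfl
  have := vertexOrder_single (ordMonoidWithZeroHom_ne_zero_of_ne_zero R) P hf
  simp [differential, Fin.sum_univ_two, hface, this, h0, h1, sub_eq_add_neg]

/-- The function on `Δ¹` with the values `1` and `a` at the ends. -/
def linearSimplexFunction {A : Type*} [CommRing A] (a : A) : SimplexRing A 1 :=
  coord A 0 + a • coord A 1

@[simp]
theorem vertex_zero_linearSimplexFunction {A : Type*} [CommRing A] (a : A) :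
    vertex A 0 (linearSimplexFunction a) = 1 := by
  simp [linearSimplexFunction]

@[simp]
theorem vertex_one_linearSimplexFunction {A : Type*} [CommRing A] (a : A) :
    vertex A 1 (linearSimplexFunction a) = a := by
  simp [linearSimplexFunction]

theorem exists_vertexOrder_eq_one {A : Type*} [CommRing A] [IsDomain A] [IsNoetherianRing A]
    [UniqueFactorizationMonoid A] {w : A →*₀ WithZero (Multiplicative ℤ)}
    (hw : ∀ a, a ≠ 0 → w a ≠ 0) {a : A} (ha : a ≠ 0) (hwa : WithZero.log (w a) = 1) :
    ∃ z, vertexOrder w z = 1 := by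
  refine ⟨_, (vertexOrder_divisor hw (linearSimplexFunction a) fun j => ?_).trans ?_⟩
  · fin_cases j
    · exact (vertex_zero_linearSimplexFunction a).trans_ne one_ne_zero
    · exact (vertex_one_linearSimplexFunction a).trans_ne ha
  · simp [hwa]

instance : Subsingleton (HigherChow R 1 0) := by
  obtain ⟨π, hπ⟩ := IsDiscreteValuationRing.exists_irreducible R
  obtain ⟨z, hz⟩ := exists_vertexOrder_eq_one (ordMonoidWithZeroHom_ne_zero_of_ne_zero R)
    hπ.ne_zero (log_ordMonoidWithZeroHom_of_irreducible R hπ)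
  refine subsingleton_of_forall_eq 0 fun x => ?_
  induction x using QuotientAddGroup.induction_on with
  | H c =>
    rw [QuotientAddGroup.eq_zero_iff]
    refine ⟨c.1 default • z, ?_⟩
    ext
    rw [map_zsmul, Finsupp.smul_apply, differential_apply_default, hz]
    simp

end DiscreteValuationRing

/-! ### The boundary map -/

section Boundary

open AdmissibleCycle SimplexRing

variable (R : Type*) [CommRing R] (F : Type*) [Field F] [Algebra R F] [IsFractionRing R F]

theorem SimplexRing.map_comap_baseMap (n : ℕ) (I : Ideal (SimplexRing F n)) :
    (I.comap (baseMap R F n)).map (baseMap R F n) = I := by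
  let := (baseMap R F n).toAlgebra
  have := isLocalization_baseMap R (nonZeroDivisors R) F n
  exact IsLocalization.map_under ((nonZeroDivisors R).map (algebraMap R (SimplexRing R n))) _ I

theorem SimplexRing.height_comap_baseMap (n : ℕ) (I : Ideal (SimplexRing F n)) :
    (I.comap (baseMap R F n)).height = I.height := by
  let := (baseMap R F n).toAlgebra
  have := isLocalization_baseMap R (nonZeroDivisors R) F n
  exact IsLocalization.height_under ((nonZeroDivisors R).map (algebraMap R (SimplexRing R n))) I

variable {R F} in
theorem SimplexRing.exists_comap_baseMap_eq {n : ℕ} (P : PrimeSpectrum (SimplexRing R n))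
    (hP : ∀ r ∈ nonZeroDivisors R, algebraMap R _ r ∉ P.asIdeal) :
    ∃ Q : PrimeSpectrum (SimplexRing F n), PrimeSpectrum.comap (baseMap R F n) Q = P := by
  let := (baseMap R F n).toAlgebra
  have := isLocalization_baseMap R (nonZeroDivisors R) F n
  have hd : Disjoint (((nonZeroDivisors R).map (algebraMap R (SimplexRing R n)) :
      Submonoid (SimplexRing R n)) : Set (SimplexRing R n)) P.asIdeal := by
    rw [Set.disjoint_left]
    rintro _ ⟨r, hr, rfl⟩
    exact hP r hr
  refine ⟨⟨P.asIdeal.map (baseMap R F n),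
    IsLocalization.isPrime_of_isPrime_disjoint _ (SimplexRing F n) _ P.isPrime hd⟩, ?_⟩
  exact PrimeSpectrum.ext
    (IsLocalization.under_map_of_isPrime_disjoint _ (SimplexRing F n) P.isPrime hd)

theorem SimplexRing.comap_baseMap_injective (n : ℕ) :
    Function.Injective (PrimeSpectrum.comap (baseMap R F n)) := by
  intro P Q h
  have h' := congrArg PrimeSpectrum.asIdeal h
  rw [PrimeSpectrum.comap_asIdeal, PrimeSpectrum.comap_asIdeal] at h'
  have h'' := congrArg (Ideal.map (baseMap R F n)) h'
  rw [map_comap_baseMap, map_comap_baseMap] at h''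
  exact PrimeSpectrum.ext h''

variable [IsDomain R]

variable {F} in
/-- The closure in `Spec R × Δⁿ` of an admissible divisor on the generic fibre. -/
def AdmissiblePrime.closure {n : ℕ} (Q : AdmissiblePrime F 1 n) : AdmissiblePrime R 1 n :=
  AdmissiblePrime.ofVertex (PrimeSpectrum.comap (baseMap R F n) Q.1)
    ((height_comap_baseMap R F n Q.1.asIdeal).trans Q.height_eq_one) fun j hj => by
      apply Q.not_le_ker_vertex j
      rw [← map_comap_baseMap R F n Q.1.asIdeal, Ideal.map_le_iff_le_comap]
      intro x hx
      rw [Ideal.mem_comap, RingHom.mem_ker, vertex_baseMap, (hj hx : vertex R j x = 0), map_zero]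

variable {F} in
@[simp]
theorem AdmissiblePrime.closure_val {n : ℕ} (Q : AdmissiblePrime F 1 n) :
    (Q.closure R).1 = PrimeSpectrum.comap (baseMap R F n) Q.1 :=
  rfl

theorem AdmissiblePrime.closure_injective (n : ℕ) :
    Function.Injective (AdmissiblePrime.closure R (F := F) (n := n)) := fun _ _ h =>
  Subtype.ext (comap_baseMap_injective R F n (congrArg Subtype.val h))

variable {R} in
theorem AdmissiblePrime.mem_range_closure {n : ℕ} (P : AdmissiblePrime R 1 n)
    (hP : ∀ r : R, r ≠ 0 → algebraMap R _ r ∉ P.1.asIdeal) :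
    P ∈ Set.range (AdmissiblePrime.closure R (F := F) (n := n)) := by
  obtain ⟨Q, hQ⟩ := exists_comap_baseMap_eq (F := F) P.1
    fun r hr => hP r (nonZeroDivisors.ne_zero hr)
  refine ⟨AdmissiblePrime.ofVertex Q ?_ fun j hj => ?_, Subtype.ext hQ⟩
  · rw [← height_comap_baseMap R F n Q.asIdeal]
    exact (congrArg (fun P => P.asIdeal.height) hQ).trans P.height_eq_one
  · apply P.not_le_ker_vertex j
    rw [← hQ]
    intro x hx
    apply FaithfulSMul.algebraMap_injective R F
    rw [map_zero]
    exact (vertex_baseMap j x).symm.trans (hj hx)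

theorem toPoints_closure {n : ℕ} (ξ : AdmissibleCycle F 1 n)
    (Q : PrimeSpectrum (SimplexRing F n)) :
    ξ.toPoints Q = AdmissibleCycle.toPoints (ξ.mapDomain (AdmissiblePrime.closure R))
      (PrimeSpectrum.comap (baseMap R F n) Q) := by
  have : AdmissibleCycle.toPoints (ξ.mapDomain (AdmissiblePrime.closure R)) =
      ξ.toPoints.mapDomain (PrimeSpectrum.comap (baseMap R F n)) :=
    Finsupp.mapDomain_comp.symm.trans (Finsupp.mapDomain_comp (v := ξ)
      (f := fun P : AdmissiblePrime F 1 n => P.1) (g := PrimeSpectrum.comap (baseMap R F n)))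
  rw [this, Finsupp.mapDomain_apply (comap_baseMap_injective R F n)]

variable [IsDiscreteValuationRing R]

theorem ordFrac_ne_zero (x : F) (hx : x ≠ 0) : Ring.ordFrac R x ≠ 0 :=
  (map_ne_zero (Ring.ordFrac R (K := F))).2 hx

theorem vertexOrder_closure (ξ : AdmissibleCycle F 1 1) :
    vertexOrder (Ring.ordMonoidWithZeroHom R) (ξ.mapDomain (AdmissiblePrime.closure R)) =
      vertexOrder (Ring.ordFrac R) ξ := by
  suffices h : (vertexOrder (Ring.ordMonoidWithZeroHom R)).comp
      (Finsupp.mapDomain.addMonoidHom (AdmissiblePrime.closure R)) =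
      vertexOrder (Ring.ordFrac R (K := F)) from DFunLike.congr_fun h ξ
  refine Finsupp.addHom_ext' fun Q => AddMonoidHom.ext_int ?_
  have hf := (Q.closure R).asIdeal_eq_span_generator
  have hv := (Q.closure R).vertex_ne_zero hf
  have hQ : Q.1.asIdeal = Ideal.span {baseMap R F 1 (Q.closure R).generator} := by
    refine (map_comap_baseMap R F 1 Q.1.asIdeal).symm.trans ?_
    have h := congrArg (Ideal.map (baseMap R F 1)) hf
    rwa [Ideal.map_span, Set.image_singleton] at h
  have hR := vertexOrder_single (ordMonoidWithZeroHom_ne_zero_of_ne_zero R) (Q.closure R) hf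
  have hF := vertexOrder_single (ordFrac_ne_zero R F) Q hQ
  rw [vertex_baseMap, vertex_baseMap, Ring.ordFrac_eq_ord R (hv _),
    Ring.ordFrac_eq_ord R (hv _)] at hF
  simpa [Finsupp.mapDomain_single] using hR.trans hF.symm

/-- A vertical divisor has no boundary. -/
theorem vertexOrder_single_of_notMem_range (P : AdmissiblePrime R 1 1)
    (hP : P ∉ Set.range (AdmissiblePrime.closure R (F := F) (n := 1))) :
    vertexOrder (Ring.ordMonoidWithZeroHom R) (Finsupp.single P 1) = 0 := by
  obtain ⟨π, hπ⟩ := IsDiscreteValuationRing.exists_irreducible R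
  have hprime := P.1.isPrime
  have hmem : algebraMap R _ π ∈ P.1.asIdeal := by
    by_contra h
    refine hP (P.mem_range_closure F fun r hr hrP => ?_)
    obtain ⟨m, u, rfl⟩ := IsDiscreteValuationRing.eq_unit_mul_pow_irreducible hr hπ
    rw [map_mul, map_pow] at hrP
    rcases hprime.mem_or_mem hrP with h' | h'
    · exact hprime.ne_top (Ideal.eq_top_of_isUnit_mem _ h' (u.isUnit.map _))
    · exact h (hprime.mem_of_pow_mem _ h')
  have hspan := P.1.asIdeal.eq_span_singleton_of_height_eq_one P.height_eq_one hmem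
    (prime_algebraMap hπ.prime 1)
  rw [vertexOrder_single (ordMonoidWithZeroHom_ne_zero_of_ne_zero R) P hspan]
  simp

theorem toPoints_single {A : Type*} [CommRing A] {p n : ℕ} (P : AdmissiblePrime A p n) (m : ℤ) :
    AdmissibleCycle.toPoints (Finsupp.single P m) = Finsupp.single P.1 m :=
  Finsupp.mapDomain_single

theorem toPoints_val {A : Type*} [CommRing A] {p n : ℕ} (c : AdmissibleCycle A p n)
    (P : AdmissiblePrime A p n) : c.toPoints P.1 = c P :=
  Finsupp.mapDomain_apply Subtype.val_injective c P

variable {R F} in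
theorem vertexOrder_eq_of_restrict {z : AdmissibleCycle R 1 1} {ξ : AdmissibleCycle F 1 1}
    (h : ∀ Q, ξ.toPoints Q = z.toPoints (PrimeSpectrum.comap (baseMap R F 1) Q)) :
    vertexOrder (Ring.ordMonoidWithZeroHom R) z = vertexOrder (Ring.ordFrac R) ξ := by
  rw [← vertexOrder_closure R F, ← sub_eq_zero, ← map_sub]
  set d := z - ξ.mapDomain (AdmissiblePrime.closure R) with hd
  have hoff (Q : AdmissiblePrime F 1 1) : d (Q.closure R) = 0 := by
    rw [hd, Finsupp.sub_apply, Finsupp.mapDomain_apply (AdmissiblePrime.closure_injective R F 1),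
      ← toPoints_val z, ← toPoints_val ξ, h Q.1, AdmissiblePrime.closure_val, sub_self]
  rw [← d.sum_single, Finsupp.sum, map_sum]
  refine Finset.sum_eq_zero fun P hP => ?_
  have hP' : P ∉ Set.range (AdmissiblePrime.closure R (F := F) (n := 1)) := by
    rintro ⟨Q, rfl⟩
    exact Finsupp.mem_support_iff.1 hP (hoff Q)
  rw [← mul_one (d P), ← smul_eq_mul, ← Finsupp.smul_single, map_zsmul,
    vertexOrder_single_of_notMem_range R F P hP', smul_zero]

theorem toPoints_eq_mapDomain_iff (c : AdmissibleCycle R 1 0)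
    (w : AdmissibleCycle (IsLocalRing.ResidueField R) 0 0) :
    c.toPoints = w.toPoints.mapDomain
      (PrimeSpectrum.comap (baseMap R (IsLocalRing.ResidueField R) 0)) ↔
    c default = w default := by
  have hc : c.toPoints = Finsupp.single (closedSimplexPoint R) (c default) := by
    conv_lhs => rw [Finsupp.unique_single c]
    rw [toPoints_single, AdmissiblePrime.default_val]
  have hw : w.toPoints.mapDomain
      (PrimeSpectrum.comap (baseMap R (IsLocalRing.ResidueField R) 0)) =
      Finsupp.single (closedSimplexPoint R) (w default) := by
    conv_lhs => rw [Finsupp.unique_single w]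
    rw [toPoints_single, Finsupp.mapDomain_single]
  rw [hc, hw]
  exact (Finsupp.single_injective _).eq_iff

/-- The order of the class of a divisor on `Δ¹` over the generic point. -/
def HigherChow.order : HigherChow F 1 1 →+ ℤ :=
  QuotientAddGroup.lift _ ((vertexOrder (Ring.ordFrac R)).comp (closedCycles F 1 1).subtype) (by
    rintro c ⟨b, hb⟩
    change vertexOrder _ c.1 = 0
    change _ = c.1 at hb
    rw [← hb, vertexOrder_differential (ordFrac_ne_zero R F)])

theorem HigherChow.order_mk (c : closedCycles F 1 1) :
    HigherChow.order R F (c : HigherChow F 1 1) = vertexOrder (Ring.ordFrac R) c.1 :=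
  rfl

theorem HigherChow.order_surjective : Function.Surjective (HigherChow.order R F) := by
  obtain ⟨π, hπ⟩ := IsDiscreteValuationRing.exists_irreducible R
  have hπF : algebraMap R F π ≠ 0 := by simpa using hπ.ne_zero
  obtain ⟨z, hz⟩ := exists_vertexOrder_eq_one (ordFrac_ne_zero R F) hπF (by
    rw [Ring.ordFrac_eq_ord R hπ.ne_zero, log_ordMonoidWithZeroHom_of_irreducible R hπ])
  intro m
  refine ⟨m • QuotientAddGroup.mk ⟨z, by simp [closedCycles_field]⟩, ?_⟩
  rw [map_zsmul, HigherChow.order_mk, hz, smul_eq_mul, mul_one]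

/-- The boundary map of the localization sequence of a discrete valuation ring. -/
def localizationBoundary : HigherChow F 1 1 →+ HigherChow (IsLocalRing.ResidueField R) 0 0 :=
  (HigherChow.degree (IsLocalRing.ResidueField R)).symm.toAddMonoidHom.comp (HigherChow.order R F)

theorem localizationBoundary_eq_iff {x : HigherChow F 1 1}
    {y : HigherChow (IsLocalRing.ResidueField R) 0 0} :
    localizationBoundary R F x = y ↔
      HigherChow.order R F x = HigherChow.degree (IsLocalRing.ResidueField R) y :=
  (HigherChow.degree (IsLocalRing.ResidueField R)).symm_apply_eq

theorem localizationBoundary_surjective : Function.Surjective (localizationBoundary R F) :=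
  (HigherChow.degree (IsLocalRing.ResidueField R)).symm.surjective.comp
    (HigherChow.order_surjective R F)

theorem isLocalizationBoundary_localizationBoundary :
    IsLocalizationBoundary R F (localizationBoundary R F) := by
  intro x y
  rw [localizationBoundary_eq_iff]
  constructor
  · induction x using QuotientAddGroup.induction_on with | H ξ
    induction y using QuotientAddGroup.induction_on with | H w
    intro h
    refine ⟨ξ.1.mapDomain (AdmissiblePrime.closure R), ξ, w, rfl, rfl, toPoints_closure R F ξ.1, ?_⟩
    refine (toPoints_eq_mapDomain_iff R _ w.1).2 ?_
    rw [differential_apply_default, vertexOrder_closure]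
    exact h
  · rintro ⟨z, ξ, w, rfl, rfl, hξ, hw⟩
    have h := (toPoints_eq_mapDomain_iff R _ w.1).1 hw
    rw [differential_apply_default, vertexOrder_eq_of_restrict hξ] at h
    exact h

end Boundary

/-! ### The lattice -/

section Lattice

open LinearMap

variable (R : Type*) [CommRing R] [IsDomain R] [IsDiscreteValuationRing R]

/-- The degree as a linear equivalence. -/
def HigherChow.degreeLinear (A : Type*) [CommRing A] [IsDomain A] [IsNoetherianRing A] :
    HigherChow A 0 0 ≃ₗ[ℤ] ℤ :=
  (HigherChow.degree A).toIntLinearEquiv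

instance (A : Type*) [CommRing A] [IsDomain A] [IsNoetherianRing A] :
    Module.Free ℤ (HigherChow A 0 0) :=
  Module.Free.of_equiv (HigherChow.degreeLinear A).symm

instance (A : Type*) [CommRing A] [IsDomain A] [IsNoetherianRing A] :
    Module.Finite ℤ (HigherChow A 0 0) :=
  Module.Finite.equiv (HigherChow.degreeLinear A).symm

theorem HigherChow.finrank_codim_zero (A : Type*) [CommRing A] [IsDomain A] [IsNoetherianRing A] :
    Module.finrank ℤ (HigherChow A 0 0) = 1 := by
  rw [(HigherChow.degreeLinear A).finrank_eq, Module.finrank_self]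

theorem finrank_deligneH1 : Module.finrank ℚ (DeligneH1 R) = 1 := by
  rw [Module.finrank_baseChange, HigherChow.finrank_codim_zero]

variable {R} {F : Type*} [Field F]
  {bd : HigherChow F 1 1 →+ HigherChow (IsLocalRing.ResidueField R) 0 0}

theorem range_regulator (hbd : Function.Surjective bd) :
    range (regulator R F bd) =
      range (TensorProduct.mk ℤ ℚ (HigherChow (IsLocalRing.ResidueField R) 0 0) 1) :=
  range_comp_of_range_eq_top _ (range_eq_top.2 hbd)

theorem isFullSublattice_range_regulator (hbd : Function.Surjective bd) :
    IsFullSublattice (range (regulator R F bd)) := by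
  rw [range_regulator hbd]
  refine ⟨Module.Finite.iff_fg.1 inferInstance, ?_⟩
  rw [eq_top_iff]
  intro x _
  induction x using TensorProduct.induction_on with
  | zero => exact zero_mem _
  | add x y hx hy => exact add_mem (hx trivial) (hy trivial)
  | tmul q y =>
    have : q ⊗ₜ[ℤ] y = q • ((1 : ℚ) ⊗ₜ[ℤ] y) := by
      rw [TensorProduct.smul_tmul', smul_eq_mul, mul_one]
    rw [this]
    exact Submodule.smul_mem _ _ (Submodule.subset_span ⟨y, rfl⟩)

theorem finrank_range_regulator (hbd : Function.Surjective bd) :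
    Module.finrank ℤ (range (regulator R F bd)) = 1 := by
  have hinj : Function.Injective
      (TensorProduct.mk ℤ ℚ (HigherChow (IsLocalRing.ResidueField R) 0 0) 1) :=
    Module.Flat.tensorProduct_mk_injective ℤ _ ℚ
  have h := LinearMap.finrank_range_of_inj hinj
  rw [HigherChow.finrank_codim_zero] at h
  rw [range_regulator hbd]
  exact h

theorem rationalRegulator_surjective (hbd : Function.Surjective bd) :
    Function.Surjective (rationalRegulator R F bd) :=
  LinearMap.lTensor_surjective ℚ (g := bd.toIntLinearMap) hbd

end Lattice

/-! ### The local factor -/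

section LFactor

variable (R : Type*) [CommRing R] (F : Type*) [Field F] [Algebra R F]

theorem galoisAction_eq_id (ℓ : ℕ) [Fact ℓ.Prime]
    (σ : AlgebraicClosure F ≃ₐ[F] AlgebraicClosure F) :
    galoisAction F ℓ σ = LinearMap.id := by
  ext f x
  exact congrArg f (Subsingleton.elim _ _)

theorem finrank_ellAdicH0 (E : Type*) [Field E] (ℓ : ℕ) [Fact ℓ.Prime] :
    Module.finrank ℚ_[ℓ] (EllAdicH0 E ℓ) = 1 := by
  have e : EllAdicH0 E ℓ ≃ₗ[ℚ_[ℓ]] ℚ_[ℓ] :=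
    LinearEquiv.ofBijective (LocallyConstant.evalₗ ℚ_[ℓ] (default : PrimeSpectrum E)) (by
      refine ⟨fun f g h => ?_, fun c => ⟨LocallyConstant.const _ c, rfl⟩⟩
      ext x
      rw [Subsingleton.elim x default]
      exact h)
  rw [e.finrank_eq, Module.finrank_self]

theorem inertiaInvariants_eq_top (ℓ : ℕ) [Fact ℓ.Prime] : inertiaInvariants R F ℓ = ⊤ := by
  rw [eq_top_iff]
  intro f _ σ _
  rw [galoisAction_eq_id]
  rfl

theorem finrank_inertiaInvariants (ℓ : ℕ) [Fact ℓ.Prime] :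
    Module.finrank ℚ_[ℓ] (inertiaInvariants R F ℓ) = 1 := by
  rw [inertiaInvariants_eq_top, finrank_top, finrank_ellAdicH0]

theorem localLFactor_eq [IsDomain R] [IsDiscreteValuationRing R] [IsFractionRing R F] (ℓ : ℕ) [Fact ℓ.Prime] (ι : ℚ_[ℓ] →+* ℂ)
    (σ : AlgebraicClosure F ≃ₐ[F] AlgebraicClosure F) (s : ℂ) :
    localLFactor R F ℓ ι σ s = (1 - (Nat.card (IsLocalRing.ResidueField R) : ℂ) ^ (-s))⁻¹ := by
  let := ι.toAlgebra
  have hrestrict : (galoisAction F ℓ σ).restrict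
      (galoisAction_mem_inertiaInvariants R F ℓ σ) = LinearMap.id := by
    ext1 f
    refine Subtype.ext ?_
    rw [LinearMap.coe_restrict_apply, galoisAction_eq_id]
    rfl
  have key (c : ℂ) : LinearMap.det ((LinearMap.id : (ℂ ⊗[ℚ_[ℓ]] inertiaInvariants R F ℓ) →ₗ[ℂ] _) -
      c • LinearMap.id) = 1 - c := by
    have h : (LinearMap.id : (ℂ ⊗[ℚ_[ℓ]] inertiaInvariants R F ℓ) →ₗ[ℂ] _) - c • LinearMap.id =
        (1 - c) • LinearMap.id := by
      ext
      simp [sub_smul]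
    rw [h, LinearMap.det_smul, LinearMap.det_id, Module.finrank_baseChange,
      finrank_inertiaInvariants, pow_one, mul_one]
  unfold localLFactor
  rw [hrestrict, LinearMap.baseChange_id, key]

theorem meromorphicOrderAt_inv_one_sub_natCast_cpow {q : ℕ} (hq : 1 < q) :
    meromorphicOrderAt (fun s : ℂ => (1 - (q : ℂ) ^ (-s))⁻¹) 0 = ((-1 : ℤ) : WithTop ℤ) := by
  have hq0 : (q : ℂ) ≠ 0 := by exact_mod_cast (by omega : q ≠ 0)
  have hd (s : ℂ) : HasDerivAt (fun s : ℂ => 1 - (q : ℂ) ^ (-s))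
      ((q : ℂ) ^ (-s) * Complex.log q) s := by
    have := ((hasDerivAt_neg s).const_cpow (c := (q : ℂ)) (Or.inl hq0)).const_sub 1
    simpa using this
  have han : AnalyticAt ℂ (fun s : ℂ => 1 - (q : ℂ) ^ (-s)) 0 :=
    (Differentiable.analyticAt (fun s => (hd s).differentiableAt) 0)
  have hlog : Complex.log q ≠ 0 := by
    rw [← Complex.natCast_log, Complex.ofReal_ne_zero]
    exact (Real.log_pos (by exact_mod_cast hq)).ne'
  have hone : analyticOrderAt (fun s : ℂ => 1 - (q : ℂ) ^ (-s)) 0 = 1 := by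
    refine han.analyticOrderAt_eq_one_of_zero_deriv_ne_zero (by simp) ?_
    rw [(hd 0).deriv]
    simpa using hlog
  have hm : meromorphicOrderAt (fun s : ℂ => 1 - (q : ℂ) ^ (-s)) 0 = ((1 : ℤ) : WithTop ℤ) := by
    rw [han.meromorphicOrderAt_eq, hone]
    rfl
  rw [fun_meromorphicOrderAt_inv, hm]
  rfl

end LFactor

/-! ### The residue field of the completion at a finite place -/

section Residue

open IsDedekindDomain HeightOneSpectrum

variable {A : Type*} [CommRing A] [IsDedekindDomain A]
  (K : Type*) [Field K] [Algebra A K] [IsFractionRing A K] (v : HeightOneSpectrum A)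

theorem mem_maximalIdeal_adicCompletionIntegers {x : v.adicCompletionIntegers K} :
    x ∈ IsLocalRing.maximalIdeal (v.adicCompletionIntegers K) ↔
      Valued.v (x : v.adicCompletion K) < 1 := by
  rw [IsLocalRing.mem_maximalIdeal, mem_nonunits_iff,
    adicCompletionIntegers.isUnit_iff_valued_eq_one]
  exact (lt_iff_le_and_ne.trans (and_iff_right x.2)).symm

theorem residue_algebraMap_surjective :
    Function.Surjective ((IsLocalRing.residue (v.adicCompletionIntegers K)).comp
      (algebraMap A (v.adicCompletionIntegers K))) := by
  intro y
  obtain ⟨x, rfl⟩ := IsLocalRing.residue_surjective y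
  have hopen : IsOpen {y : v.adicCompletion K | Valued.v (y - x) < 1} := by
    have h := (Valued.isOpen_ball (v.adicCompletion K) 1).preimage
      (continuous_id.sub continuous_const : Continuous fun y => y - (x : v.adicCompletion K))
    simpa [Valuation.restrict_lt_one_iff] using h
  obtain ⟨k, hk⟩ := (denseRange_algebraMap K v).exists_mem_open hopen ⟨x, by simp⟩
  have hk1 : v.valuation K k ≤ 1 := by
    rw [← valuedAdicCompletion_eq_valuation']
    have := Valuation.map_add Valued.v ((k : v.adicCompletion K) - x) x
    rw [sub_add_cancel] at this
    exact this.trans (max_le (le_of_lt hk) x.2)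
  obtain ⟨a, ha⟩ := exists_valuation_sub_lt_of_integer v hk1 1
  refine ⟨a, ?_⟩
  rw [RingHom.comp_apply, ← sub_eq_zero, ← map_sub, IsLocalRing.residue_eq_zero_iff,
    mem_maximalIdeal_adicCompletionIntegers]
  have h := Valuation.map_add Valued.v (algebraMap K (v.adicCompletion K) (algebraMap A K a - k))
    (algebraMap K (v.adicCompletion K) k - x)
  have e : algebraMap K (v.adicCompletion K) (algebraMap A K a - k) +
      (algebraMap K (v.adicCompletion K) k - x) =
      ((algebraMap A (v.adicCompletionIntegers K) a - x : v.adicCompletionIntegers K) :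
        v.adicCompletion K) := by
    rw [map_sub, sub_add_sub_cancel]
    rfl
  rw [e] at h
  exact h.trans_lt (max_lt ((valuedAdicCompletion_eq_valuation' v _).trans_lt ha) hk)

theorem finite_residueField_adicCompletionIntegers [Finite (A ⧸ v.asIdeal)] :
    Finite (IsLocalRing.ResidueField (v.adicCompletionIntegers K)) := by
  let f := (IsLocalRing.residue (v.adicCompletionIntegers K)).comp
      (algebraMap A (v.adicCompletionIntegers K))
  have hf : ∀ a ∈ v.asIdeal, f a = 0 := by
    intro a ha
    rw [RingHom.comp_apply, IsLocalRing.residue_eq_zero_iff,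
      mem_maximalIdeal_adicCompletionIntegers]
    exact (valuedAdicCompletion_eq_valuation' v _).trans_lt ((v.valuation_lt_one_iff_mem a).2 ha)
  exact Finite.of_surjective _
    (Ideal.Quotient.lift_surjective_of_surjective v.asIdeal hf (residue_algebraMap_surjective K v))

end Residue

end

theorem mainTheorem1 (K : Type*) [Field K] [NumberField K]
    (v : IsDedekindDomain.HeightOneSpectrum (NumberField.RingOfIntegers K)) :
    -- `CH^1(Spec Λ)` and `CH^1(v)` vanish, so that `i^* i_* = 0` on `CH^0(v)`
    Subsingleton (HigherChow (v.adicCompletionIntegers K) 1 0) ∧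
    Subsingleton
      (HigherChow (IsLocalRing.ResidueField (v.adicCompletionIntegers K)) 1 0) ∧
    -- the boundary map of the localization sequence
    ∃ bd : HigherChow (v.adicCompletion K) 1 1 →+
        HigherChow (IsLocalRing.ResidueField (v.adicCompletionIntegers K)) 0 0,
      IsLocalizationBoundary (v.adicCompletionIntegers K) (v.adicCompletion K) bd ∧
      -- surjectivity of the regulator, integrally and rationally
      Function.Surjective bd ∧
      Function.Surjective
        (rationalRegulator (v.adicCompletionIntegers K) (v.adicCompletion K) bd) ∧
      -- its image is a full sublattice, of rank one, in a one-dimensional space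
      IsFullSublattice
        (LinearMap.range (regulator (v.adicCompletionIntegers K) (v.adicCompletion K) bd)) ∧
      Module.finrank ℤ
        (LinearMap.range
          (regulator (v.adicCompletionIntegers K) (v.adicCompletion K) bd)) = 1 ∧
      Module.finrank ℚ (DeligneH1 (v.adicCompletionIntegers K)) = 1 ∧
      -- the function `1 / (1 - N(v)^{-s})` has a pole of order one at `s = 0`
      meromorphicOrderAt (fun s : ℂ =>
        (1 - (Nat.card (IsLocalRing.ResidueField (v.adicCompletionIntegers K)) : ℂ) ^ (-s))⁻¹) 0
        = ((-1 : ℤ) : WithTop ℤ) ∧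
      -- it is the local `L`-factor, whose pole order is the rank of the image
      ∀ (ℓ : ℕ) [Fact ℓ.Prime],
        (ℓ : IsLocalRing.ResidueField (v.adicCompletionIntegers K)) ≠ 0 →
        ∀ (ι : ℚ_[ℓ] →+* ℂ)
          (σ : AlgebraicClosure (v.adicCompletion K) ≃ₐ[v.adicCompletion K]
            AlgebraicClosure (v.adicCompletion K)),
          IsGeometricFrobenius (v.adicCompletionIntegers K) (v.adicCompletion K) σ →
          (∀ s : ℂ,
            localLFactor (v.adicCompletionIntegers K) (v.adicCompletion K) ℓ ι σ s =
              (1 - (Nat.card (IsLocalRing.ResidueField (v.adicCompletionIntegers K)) : ℂ)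
                ^ (-s))⁻¹) ∧
          meromorphicOrderAt
              (localLFactor (v.adicCompletionIntegers K) (v.adicCompletion K) ℓ ι σ) 0 =
            ((-(Module.finrank ℤ
              (LinearMap.range
                (regulator (v.adicCompletionIntegers K) (v.adicCompletion K) bd)) : ℤ) : ℤ) :
              WithTop ℤ) := by
  have : Finite (NumberField.RingOfIntegers K ⧸ v.asIdeal) :=
    v.asIdeal.finiteQuotientOfFreeOfNeBot v.ne_bot
  have : Finite (IsLocalRing.ResidueField (v.adicCompletionIntegers K)) :=
    finite_residueField_adicCompletionIntegers K v
  have hsurj := localizationBoundary_surjective (v.adicCompletionIntegers K) (v.adicCompletion K)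
  have hpole := meromorphicOrderAt_inv_one_sub_natCast_cpow
    (Finite.one_lt_card (α := IsLocalRing.ResidueField (v.adicCompletionIntegers K)))
  refine ⟨inferInstance, inferInstance, localizationBoundary _ _,
    isLocalizationBoundary_localizationBoundary _ _, hsurj, rationalRegulator_surjective hsurj,
    isFullSublattice_range_regulator hsurj, finrank_range_regulator hsurj, finrank_deligneH1 _,
    hpole, fun ℓ _ _ ι σ _ => ⟨localLFactor_eq _ _ ℓ ι σ, ?_⟩⟩
  rw [funext (localLFactor_eq _ _ ℓ ι σ), hpole, finrank_range_regulator hsurj]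
  rfl
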